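/- **Conventions.** Let $V$ be a universal multitape Turing machine (not necessarily prefix-free) whose programs are binary strings, and write $T(p)$ for its halting time on program $p$. The plain complexity is $C(x)=\min\{\ell(p) : V(p)=x\}$, and for $z\in\mathbb N$ the logical depth is $\mathrm{Depth}_z(x)=\min\{T(p) : V(p)=x,\ \ell(p)-C(x)\le z\}$. Let $U$ be a universal prefix computer; its programs may receive an additional input $y$, and for each fixed $y$ the halting programs form a prefix-free set. $K(x)=\min\{\ell(p): U(p)=x\}$ is the prefix complexity of a string or natural number $x$, and for a computable function $f:\mathbb N\to\mathbb N$, $K(f)$ is the length of a shortest program $p$ with $U(p,n)=f(n)$ for all $n$. An *ensemble* is a probability distribution $\mathbb E$ on $\{0,1\}^*$ that is computable and whose entropy $H(\mathbb E)=-\sum_s \mathbb E(s)\log_2\mathbb E(s)$ is finite and computable. $K(\mathbb E)$ is the length of a shortest program for $U$ that computes $\mathbb E(s)$ (given $s$ and $n$, up to $2^{-n}$) and also $H(\mathbb E)$ (given $n$, up to $2^{-n}$), and $\Sigma(\mathbb E)=K(\mathbb E)+H(\mathbb E)$. For $\delta,\Delta\ge 0$ the effective complexity of a string $x$ is $$\mathcal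 E_{\delta,\Delta}(x)=\inf\{K(\mathbb E) : \mathbb E(x)\ge 2^{-H(\mathbb E)(1+\delta)},\ \Sigma(\mathbb E)\le K(x)+\Delta\},$$ with value $\infty$ if the set is empty. A string $x$ is *$k$-well-behaved* ($k\in\mathbb N$) if $K(x)+k\ge C(x)+K(C(x))$. **Theorem (Effective Complexity and Depth).** There is a constant $\omega\in\mathbb N$, depending only on the reference machines $U$ and $V$, with the following property. Let $f:\mathbb N\to\mathbb N$ be any strictly increasing computable function, let $k\in\mathbb N$, and let $x$ be any $k$-well-behaved string. If $$\mathcal E_{\delta,\,k+z+K(z)+K(f)+\omega+1}(x) > K(C(x))+K(z)+K(f)+\omega$$ for some $\delta\ge 0$ and $z\in\mathbb N$, then $\mathrm{Depth}_z(x) > f(C(x))$. -/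

import Mathlib

namespace EffDepth

/-! ## Plain complexity: multitape Turing machines with their halting time -/

/-- A tape symbol: the blank `none`, a bit, or one of `m` auxiliary symbols. -/
abbrev Sym (m : ℕ) := Option (Bool ⊕ Fin m)

/-- A two-way infinite tape `(l, r)`: `r` lists the cells from the head to the right (the scanned
cell first), `l` the cells to the left of the head (the nearest first); every other cell is blank. -/
abbrev Tape (m : ℕ) := List (Sym m) × List (Sym m)

/-- The scanned symbol. -/
def Tape.read {m : ℕ} (T : Tape m) : Sym m := T.2.headD none

/-- Write `a` on the scanned cell, then move the head (`none`: the head stays). -/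
def Tape.act {m : ℕ} (T : Tape m) (a : Sym m) : Option Turing.Dir → Tape m
  | none => (T.1, a :: T.2.tail)
  | some Turing.Dir.left => (T.1.tail, T.1.headD none :: a :: T.2.tail)
  | some Turing.Dir.right => (a :: T.1, T.2.tail)

/-- The bits on the tape, from left to right. -/
def Tape.bits {m : ℕ} (T : Tape m) : List Bool :=
  (T.1.reverse ++ T.2).filterMap fun a => a.bind Sum.getLeft?

/-- A deterministic Turing machine with `k + 1` tapes, `s + 1` states (state `0` is the start
state) and `m` auxiliary symbols. In state `q`, scanning the symbols `a`, it halts if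
`δ q a = none`; otherwise `δ q a` gives the next state and, for each tape, the symbol to be written
and the head movement. -/
structure Machine where
  k : ℕ
  s : ℕ
  m : ℕ
  δ : Fin (s + 1) → (Fin (k + 1) → Sym m) →
    Option (Fin (s + 1) × (Fin (k + 1) → Sym m × Option Turing.Dir))

namespace Machine

/-- Configurations: the current state and the tapes. -/
abbrev Config (V : Machine) := Fin (V.s + 1) × (Fin (V.k + 1) → Tape V.m)

/-- The initial configuration on the program `p`: `p` stands on tape `0` with the head on its first
symbol, all other tapes are blank. -/
def init (V : Machine) (p : List Bool) : V.Config :=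
  (0, fun i => if i = 0 then ([], p.map fun b => some (Sum.inl b)) else ([], []))

/-- One step; `none` if the machine halts. -/
def step (V : Machine) (c : V.Config) : Option V.Config :=
  (V.δ c.1 fun i => (c.2 i).read).map fun d =>
    (d.1, fun i => (c.2 i).act (d.2 i).1 (d.2 i).2)

/-- The configuration after exactly `t` steps, if the machine has not halted before. -/
def stepN (V : Machine) : ℕ → V.Config → Option V.Config
  | 0, c => some c
  | t + 1, c => (V.stepN t c).bind V.step

/-- `V(p) = x` with halting time `T(p) = t`: on the program `p` the machine halts after exactly `t`
steps, and `x` is the string of bits which then stands on its last tape. -/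
def HaltsWith (V : Machine) (p : List Bool) (t : ℕ) (x : List Bool) : Prop :=
  ∃ c, V.stepN t (V.init p) = some c ∧ V.step c = none ∧ (c.2 (Fin.last V.k)).bits = x

/-- `V` is universal: it simulates every partial computable function on strings with programs that
are longer by at most a constant. -/
def IsUniversal (V : Machine) : Prop :=
  ∀ φ : List Bool →. List Bool, Partrec φ →
    ∃ c : ℕ, ∀ p x, x ∈ φ p → ∃ q, q.length ≤ p.length + c ∧ ∃ t, V.HaltsWith q t x

/-- The plain Kolmogorov complexity `C(x)`. -/
noncomputable def C (V : Machine) (x : List Bool) : ℕ :=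
  sInf {n | ∃ p t, V.HaltsWith p t x ∧ p.length = n}

/-- The logical depth of `x` at significance level `z`. -/
noncomputable def depth (V : Machine) (z : ℕ) (x : List Bool) : ℕ :=
  sInf {t | ∃ p, V.HaltsWith p t x ∧ p.length ≤ V.C x + z}

end Machine

/-! ## Prefix complexity -/

/-- `U p y` is the result of the program `p` on the input `y`. Inputs and outputs are finite
objects (strings, numbers, pairs, ...) given by their code numbers `Encodable.encode`; the input `0`
is the empty input. `U` is a prefix computer if it is partial computable and, for each input,
no proper extension of a halting program is a halting program. -/
def IsPrefixComputer (U : List Bool → ℕ →. ℕ) : Prop :=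
  Partrec₂ U ∧ ∀ p r y, (U p y).Dom → (U (p ++ r) y).Dom → r = []

/-- `U` is a universal prefix computer: for every prefix computer `M` there is a constant `c` such
that every program `p` for `M` has an equivalent program for `U` which is longer by at most `c`. -/
def IsUniversalPrefixComputer (U : List Bool → ℕ →. ℕ) : Prop :=
  IsPrefixComputer U ∧ ∀ M : List Bool → ℕ →. ℕ, IsPrefixComputer M →
    ∃ c : ℕ, ∀ p, ∃ q, q.length ≤ p.length + c ∧ ∀ y v, v ∈ M p y → v ∈ U q y

/-- The prefix complexity `K(a)` of a finite object `a` (a string or a natural number). -/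
noncomputable def K {α : Type} [Encodable α] (U : List Bool → ℕ →. ℕ) (a : α) : ℕ :=
  sInf {n | ∃ p, Encodable.encode a ∈ U p 0 ∧ p.length = n}

/-- The prefix complexity `K(f)` of a computable function: the length of a shortest program which
maps every `n` to `f n`. -/
noncomputable def KFun (U : List Bool → ℕ →. ℕ) (f : ℕ → ℕ) : ℕ :=
  sInf {l | ∃ p, (∀ n, f n ∈ U p n) ∧ p.length = l}

/-! ## Ensembles and effective complexity -/

/-- The dyadic number `a / 2 ^ n` approximates `r` with accuracy `2 ^ (-n)`. -/
def Approx (a n : ℕ) (r : ℝ) : Prop := |(a : ℝ) / 2 ^ n - r| ≤ 1 / 2 ^ n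

/-- The probability of the string `s` under `E`, as a real number. -/
noncomputable def prob (E : PMF (List Bool)) (s : List Bool) : ℝ := (E s).toReal

/-- The entropy `H(E)` in bits (meaningful if `HasFiniteEntropy E`). -/
noncomputable def entropy (E : PMF (List Bool)) : ℝ :=
  ∑' s, -(prob E s * Real.logb 2 (prob E s))

def HasFiniteEntropy (E : PMF (List Bool)) : Prop :=
  Summable fun s => -(prob E s * Real.logb 2 (prob E s))

/-- The admitted ensembles: computable, with finite and computable entropy. -/
def IsAdmissible (E : PMF (List Bool)) : Prop :=
  HasFiniteEntropy E ∧
  (∃ a : List Bool → ℕ → ℕ, Computable₂ a ∧ ∀ s n, Approx (a s n) n (prob E s)) ∧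
  (∃ h : ℕ → ℕ, Computable h ∧ ∀ n, Approx (h n) n (entropy E))

/-- The program `q` computes the ensemble `E` together with its entropy: on the input `(s, n)` it
approximates `E(s)`, and on the input `n` it approximates `H(E)`, with accuracy `2 ^ (-n)`. -/
def ComputesEnsemble (U : List Bool → ℕ →. ℕ) (q : List Bool) (E : PMF (List Bool)) : Prop :=
  (∀ (s : List Bool) (n : ℕ), ∃ a,
    a ∈ U q (Encodable.encode (Sum.inl (s, n) : (List Bool × ℕ) ⊕ ℕ)) ∧ Approx a n (prob E s)) ∧
  (∀ n : ℕ, ∃ a,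
    a ∈ U q (Encodable.encode (Sum.inr n : (List Bool × ℕ) ⊕ ℕ)) ∧ Approx a n (entropy E))

/-- The prefix complexity `K(E)` (that is, `K(E, H(E))`) of an ensemble. -/
noncomputable def KEns (U : List Bool → ℕ →. ℕ) (E : PMF (List Bool)) : ℕ :=
  sInf {l | ∃ q, ComputesEnsemble U q E ∧ q.length = l}

/-- The total information `Σ(E) = K(E) + H(E)`. -/
noncomputable def totalInfo (U : List Bool → ℕ →. ℕ) (E : PMF (List Bool)) : ℝ :=
  (KEns U E : ℝ) + entropy E

/-- `x` is `d`-typical for `E`. -/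
def IsTypical (d : ℝ) (x : List Bool) (E : PMF (List Bool)) : Prop :=
  (2 : ℝ) ^ (-(entropy E) * (1 + d)) ≤ prob E x

/-- The minimization domain of `x` for effective complexity. -/
def minDomain (U : List Bool → ℕ →. ℕ) (d D : ℝ) (x : List Bool) : Set (PMF (List Bool)) :=
  {E | IsAdmissible E ∧ IsTypical d x E ∧ totalInfo U E ≤ (K U x : ℝ) + D}

/-- The effective complexity of `x` with parameters `d` and `D`; it is `⊤` if the minimization
domain is empty. -/
noncomputable def effComplexity (U : List Bool → ℕ →. ℕ) (d D : ℝ) (x : List Bool) : ℕ∞ :=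
  ⨅ E ∈ minDomain U d D x, (KEns U E : ℕ∞)

/-- `x` is `k`-well-behaved. -/
def IsWellBehaved (U : List Bool → ℕ →. ℕ) (V : Machine) (k : ℕ) (x : List Bool) : Prop :=
  V.C x + K U (V.C x) ≤ K U x + k

end EffDepth

/-!
Suppose that `Depth_z(x) ≤ f(n)` for `n = C(x)`. Then `x` belongs to the finite set `S` of all strings
which `V` outputs within `f(n)` steps on a program of length at most `n + z`
(`Machine.mem_outputs`). The uniform ensemble `E` on `S` has entropy `log₂ |S|`, which is at most
`n + z + 1` because there are fewer than `2 ^ (n + z + 1)` such programs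
(`Machine.length_outputs_le`), and `x` is typical for `E` since `E(x) = 2 ^ (-H(E))`
(`isTypical_uniformOfFinset`).

The ensemble is cheap to describe: `K(E) ≤ K(n) + K(z) + K(f) + ω` with a constant `ω` depending on
the machines only (`exists_KEns_uniform_outputs_le`). Programs `a` for `n`, `b` for `z` and `c` for
`f` are self-delimiting, so the concatenation `a ++ b ++ c` determines them; as `c` is only run on
the input `n`, it is enough that `U` is prefix-free on each single input
(`IsPrefixComputer.exists_concat`). From `n`, `z` and `f n` the set `S`, and then `E` and `H(E)`,
are computed by primitive recursion (`Machine.primrec_outputs`, `primrec_uniformApprox`).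

As `x` is `k`-well-behaved, `n + K(n) ≤ K(x) + k`, whence
`Σ(E) ≤ K(x) + k + z + K(z) + K(f) + ω + 1`. Thus `E` lies in the minimization domain of `x` and
shows that the effective complexity is at most `K(n) + K(z) + K(f) + ω`.
-/

namespace EffDepth

open Encodable Nat.Partrec

/-! ### Searching for a halting instance -/

/-- Dovetailing: from a partial computable `g` one obtains a partial computable search which, on the
input `a`, returns a value of some `g b a` as soon as one of these computations halts. -/
theorem exists_partrec_search {α β σ : Type*} [Primcodable α] [Primcodable β] [Primcodable σ]
    {g : β → α →. σ} (hg : Partrec₂ g) :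
    ∃ h : α →. σ, Partrec h ∧ (∀ a v, v ∈ h a → ∃ b, v ∈ g b a) ∧
      ∀ a b v, v ∈ g b a → (h a).Dom := by
  obtain ⟨c, hc⟩ := Code.exists_code.1 hg
  -- `t` codes a pair (time bound, code of `b`)
  let s : α → ℕ → Option σ := fun a t =>
    (Code.evaln t.unpair.1 c (Nat.pair t.unpair.2 (encode a))).bind (decode (α := σ))
  have hs : Primrec₂ s := by
    refine Primrec.option_bind (f := fun q : α × ℕ =>
      Code.evaln q.2.unpair.1 c (Nat.pair q.2.unpair.2 (encode q.1))) ?_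
      (Primrec.decode.comp Primrec.snd).to₂
    have hu : Primrec fun q : α × ℕ => q.2.unpair := Primrec.unpair.comp Primrec.snd
    exact Code.primrec_evaln.comp
      (((Primrec.fst.comp hu).pair (Primrec.const c)).pair
        (Primrec₂.natPair.comp (Primrec.snd.comp hu) (Primrec.encode.comp Primrec.fst)))
  refine ⟨fun a => Nat.rfindOpt (s a), Partrec.rfindOpt hs.to_comp, fun a v hv => ?_,
    fun a b v hv => ?_⟩
  · obtain ⟨t, ht⟩ := Nat.rfindOpt_spec hv
    obtain ⟨m, hm, hmv⟩ := Option.bind_eq_some_iff.1 ht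
    have hm' := Code.evaln_sound hm
    rw [hc] at hm'
    obtain ⟨q, hq, hq'⟩ := Part.mem_bind_iff.1 hm'
    obtain ⟨v', hv', rfl⟩ := (Part.mem_map_iff _).1 hq'
    rw [encodek] at hmv
    obtain rfl : v' = v := by simpa using hmv
    have hq2 : q.2 = a := by
      simp only [Part.mem_ofOption, decode_prod_val, Nat.unpair_pair, encodek] at hq
      simp only [Option.map_some, Option.mem_def, Option.bind_eq_some_iff,
        Option.some.injEq] at hq
      obtain ⟨b, -, rfl⟩ := hq
      rfl
    exact ⟨q.1, hq2 ▸ hv'⟩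
  · have : encode v ∈ Code.eval c (Nat.pair (encode b) (encode a)) := by
      rw [hc]
      refine Part.mem_bind_iff.2 ⟨(b, a), ?_, Part.mem_map _ hv⟩
      simp [decode_prod_val]
    obtain ⟨k, hk⟩ := Code.evaln_complete.1 this
    refine Nat.rfindOpt_dom.2 ⟨Nat.pair k (encode b), v, ?_⟩
    simp only [s, Nat.unpair_pair]
    exact Option.bind_eq_some_iff.2 ⟨_, hk, encodek v⟩

/-! ### Prefix computers -/

variable {U : List Bool → ℕ →. ℕ}

/-- Unique parsing: a string has at most one prefix which is a halting program on `y`. -/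
theorem IsPrefixComputer.eq_of_append_eq (hU : IsPrefixComputer U) {a a' r r' : List Bool} {y : ℕ}
    (ha : (U a y).Dom) (ha' : (U a' y).Dom) (h : a ++ r = a' ++ r') : a = a' ∧ r = r' := by
  rcases List.append_eq_append_iff.1 h with ⟨e, rfl, rfl⟩ | ⟨e, rfl, rfl⟩
  · obtain rfl := hU.2 _ _ _ ha ha'
    simp
  · obtain rfl := hU.2 _ _ _ ha' ha
    simp

/-- Self-delimiting programs can be concatenated without separators: a prefix computer may run a
program `a` for a number `n`, a program `b` for a number `z` and a program `c` for the value `t` of a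
function at `n`, and postprocess `(n, z, t)` together with its input `y`. -/
theorem IsPrefixComputer.exists_concat (hU : IsPrefixComputer U) {F : ℕ × ℕ × ℕ × ℕ → ℕ}
    (hF : Computable F) :
    ∃ M, IsPrefixComputer M ∧ ∀ a b c n z t y, n ∈ U a 0 → z ∈ U b 0 → t ∈ U c n →
      F (n, z, t, y) ∈ M (a ++ (b ++ c)) y := by
  -- run the parse `p` of the program on the program and input `q`, and diverge on a wrong parse
  let g : List Bool × List Bool × List Bool → List Bool × ℕ →. ℕ := fun p q =>
    bif decide (p.1 ++ (p.2.1 ++ p.2.2) = q.1) then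
      (U p.1 0).bind fun n => (U p.2.1 0).bind fun z =>
        (U p.2.2 n).map fun t => F (n, z, t, q.2)
    else Part.none
  have mem_g : ∀ p q v, v ∈ g p q ↔ p.1 ++ (p.2.1 ++ p.2.2) = q.1 ∧ ∃ n ∈ U p.1 0, ∃ z ∈ U p.2.1 0,
      ∃ t ∈ U p.2.2 n, F (n, z, t, q.2) = v := by
    intro p q v
    by_cases h : p.1 ++ (p.2.1 ++ p.2.2) = q.1 <;> simp [g, h]
  have hg : Partrec₂ g := by
    have hp : Computable fun p : (List Bool × List Bool × List Bool) × (List Bool × ℕ) => p.1 :=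
      Computable.fst
    have h1 := Computable.fst.comp hp
    have h2 := Computable.fst.comp (Computable.snd.comp hp)
    have h3 := Computable.snd.comp (Computable.snd.comp hp)
    refine Partrec.cond ?_ ?_ Partrec.none
    · exact Primrec.eq.decide.to_comp.comp (Computable.list_append.comp h1
        (Computable.list_append.comp h2 h3)) (Computable.fst.comp Computable.snd)
    · refine Partrec.bind (hU.1.comp h1 (Computable.const 0)) ?_
      refine Partrec.bind (hU.1.comp (h2.comp Computable.fst) (Computable.const 0)) ?_
      refine Partrec.map (hU.1.comp (h3.comp (Computable.fst.comp Computable.fst))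
        (Computable.snd.comp Computable.fst)) ?_
      refine hF.comp ?_
      have e1 := Computable.fst.comp (Computable.fst (α := ((((List Bool × List Bool × List Bool) ×
        (List Bool × ℕ)) × ℕ) × ℕ)) (β := ℕ))
      exact (Computable.snd.comp e1).pair ((Computable.snd.comp Computable.fst).pair
        (Computable.snd.pair (Computable.snd.comp (Computable.snd.comp (Computable.fst.comp e1)))))
  obtain ⟨h, hh, hsound, hdom⟩ := exists_partrec_search hg
  refine ⟨fun w y => h (w, y), ⟨hh.to₂, fun w r y hw hwr => ?_⟩, fun a b c n z t y ha hb hc => ?_⟩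
  · obtain ⟨p, hp⟩ := hsound _ _ (Part.get_mem hw)
    obtain ⟨p', hp'⟩ := hsound _ _ (Part.get_mem hwr)
    obtain ⟨e, n, hn, z, hz, t, ht, -⟩ := (mem_g _ _ _).1 hp
    obtain ⟨e', n', hn', z', hz', t', ht', -⟩ := (mem_g _ _ _).1 hp'
    have key : p.1 ++ (p.2.1 ++ (p.2.2 ++ r)) = p'.1 ++ (p'.2.1 ++ (p'.2.2 ++ [])) := by
      rw [← List.append_assoc p.2.1, ← List.append_assoc p.1, e, List.append_nil, e']
    obtain ⟨e1, key⟩ := hU.eq_of_append_eq hn.fst hn'.fst key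
    obtain ⟨e2, key⟩ := hU.eq_of_append_eq hz.fst hz'.fst key
    rw [← e1] at hn'
    obtain rfl := Part.mem_unique hn hn'
    exact (hU.eq_of_append_eq ht.fst ht'.fst key).2
  · have hd := hdom (a ++ (b ++ c), y) (a, b, c) (F (n, z, t, y))
      ((mem_g _ _ _).2 ⟨rfl, n, ha, z, hb, t, hc, rfl⟩)
    -- the search might have met another halting parse, but there is only one
    obtain ⟨p, hp⟩ := hsound _ _ (Part.get_mem hd)
    obtain ⟨e, n', hn', z', hz', t', ht', hv⟩ := (mem_g _ _ _).1 hp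
    obtain ⟨e1, e⟩ := hU.eq_of_append_eq hn'.fst ha.fst e
    obtain ⟨e2, e3⟩ := hU.eq_of_append_eq hz'.fst hb.fst e
    rw [e1] at hn'
    rw [e2] at hz'
    obtain rfl := Part.mem_unique ha hn'
    obtain rfl := Part.mem_unique hb hz'
    rw [e3] at ht'
    obtain rfl := Part.mem_unique hc ht'
    exact hv ▸ Part.get_mem hd

/-- Every computable function has a program for a universal prefix computer. -/
theorem IsUniversalPrefixComputer.exists_program (hU : IsUniversalPrefixComputer U) {f : ℕ → ℕ}
    (hf : Computable f) : ∃ p, ∀ n, f n ∈ U p n := by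
  -- only the empty program halts, so `M` is trivially prefix-free
  let M : List Bool → ℕ →. ℕ := fun p y => bif decide (p = []) then Part.some (f y) else Part.none
  have mem_M : ∀ p y v, v ∈ M p y ↔ p = [] ∧ v = f y := by
    intro p y v
    by_cases h : p = [] <;> simp [M, h]
  have hM : IsPrefixComputer M := by
    refine ⟨Partrec.cond (Primrec.eq.decide.to_comp.comp Computable.fst (Computable.const []))
      (hf.comp Computable.snd).partrec Partrec.none, fun p r y _ h => ?_⟩
    exact (List.append_eq_nil_iff.1 ((mem_M _ _ _).1 (Part.get_mem h)).1).2
  obtain ⟨c, hc⟩ := hU.2 M hM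
  obtain ⟨q, -, hq⟩ := hc []
  exact ⟨q, fun n => hq n _ ((mem_M _ _ _).2 ⟨rfl, rfl⟩)⟩

theorem IsUniversalPrefixComputer.exists_length_eq_KFun (hU : IsUniversalPrefixComputer U)
    {f : ℕ → ℕ} (hf : Computable f) : ∃ p, (∀ n, f n ∈ U p n) ∧ p.length = KFun U f := by
  obtain ⟨p, hp⟩ := hU.exists_program hf
  exact Nat.sInf_mem (s := {l | ∃ p, (∀ n, f n ∈ U p n) ∧ p.length = l}) ⟨_, p, hp, rfl⟩

theorem IsUniversalPrefixComputer.exists_length_eq_K (hU : IsUniversalPrefixComputer U) (n : ℕ) :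
    ∃ p, n ∈ U p 0 ∧ p.length = K U n := by
  obtain ⟨p, hp⟩ := hU.exists_program (Computable.const n)
  exact Nat.sInf_mem (s := {l | ∃ p, encode n ∈ U p 0 ∧ p.length = l}) ⟨_, p, hp 0, rfl⟩

end EffDepth

namespace EffDepth
open Encodable

/-! ### Time-bounded runs of a Turing machine -/

namespace Machine

variable (V : Machine)

/-- One step, where a halted machine stays in its configuration. -/
def stepOrStay (c : V.Config) : V.Config := (V.step c).getD c

/-- The output of `V` on the program `p`, if `V` halts after at most `t` steps. -/
def runFor (t : ℕ) (p : List Bool) : Option (List Bool) :=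
  if V.step (V.stepOrStay^[t] (V.init p)) = none then
    some ((V.stepOrStay^[t] (V.init p)).2 (Fin.last V.k)).bits
  else none

variable {V}

theorem iterate_stepOrStay_of_step_eq_none {c : V.Config} (h : V.step c = none) (n : ℕ) :
    V.stepOrStay^[n] c = c :=
  Function.iterate_fixed (by simp [stepOrStay, h]) n

theorem iterate_stepOrStay_of_stepN {t : ℕ} {c c' : V.Config} (h : V.stepN t c = some c') :
    V.stepOrStay^[t] c = c' := by
  induction t generalizing c' with
  | zero => simpa [stepN] using h
  | succ t ih =>
    obtain ⟨d, hd, hd'⟩ := Option.bind_eq_some_iff.1 h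
    rw [Function.iterate_succ_apply', ih hd, stepOrStay, hd', Option.getD_some]

theorem exists_stepN_eq_iterate (t : ℕ) (c : V.Config) :
    ∃ t' ≤ t, V.stepN t' c = some (V.stepOrStay^[t] c) := by
  induction t with
  | zero => exact ⟨0, le_rfl, rfl⟩
  | succ t ih =>
    obtain ⟨t', ht', h⟩ := ih
    rw [Function.iterate_succ_apply']
    rcases hs : V.step (V.stepOrStay^[t] c) with _ | d
    · exact ⟨t', by omega, by rw [h, stepOrStay, hs, Option.getD_none]⟩
    · exact ⟨t' + 1, by omega, by rw [stepN, h, Option.bind_some, stepOrStay, hs, Option.getD_some]⟩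

theorem runFor_eq_some_iff {t : ℕ} {p x : List Bool} :
    V.runFor t p = some x ↔ ∃ t' ≤ t, V.HaltsWith p t' x := by
  constructor
  · intro h
    obtain ⟨t', ht', e⟩ := exists_stepN_eq_iterate t (V.init p)
    rw [runFor] at h
    split_ifs at h with hs
    exact ⟨t', ht', _, e, hs, Option.some.inj h⟩
  · rintro ⟨t', ht', c, hc, hs, hx⟩
    obtain ⟨r, rfl⟩ := Nat.exists_eq_add_of_le ht'
    have e : V.stepOrStay^[t' + r] (V.init p) = c := by
      rw [add_comm, Function.iterate_add_apply, iterate_stepOrStay_of_stepN hc,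
        iterate_stepOrStay_of_step_eq_none hs]
    rw [runFor, e, if_pos hs, hx]

theorem primrec_read {m : ℕ} : Primrec (Tape.read : Tape m → Sym m) := by
  refine (Primrec.option_getD.comp (Primrec.list_head?.comp Primrec.snd)
    (Primrec.const none)).of_eq fun T => ?_
  simp [Tape.read]

/-- Head directions, coded as Booleans. -/
instance primcodableDir : Primcodable Turing.Dir :=
  Primcodable.ofEquiv Bool
    { toFun := fun d => match d with
        | Turing.Dir.left => false
        | Turing.Dir.right => true
      invFun := fun b => bif b then Turing.Dir.right else Turing.Dir.left
      left_inv := by rintro (_ | _) <;> rfl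
      right_inv := by rintro (_ | _) <;> rfl }

theorem primrec_act {m : ℕ} :
    Primrec fun q : Tape m × (Sym m × Option Turing.Dir) => q.1.act q.2.1 q.2.2 := by
  have hl : Primrec fun q : Tape m × (Sym m × Option Turing.Dir) => q.1.1 :=
    Primrec.fst.comp Primrec.fst
  have ht : Primrec fun q : Tape m × (Sym m × Option Turing.Dir) => q.1.2.tail :=
    Primrec.list_tail.comp (Primrec.snd.comp Primrec.fst)
  have ha : Primrec fun q : Tape m × (Sym m × Option Turing.Dir) => q.2.1 :=
    Primrec.fst.comp Primrec.snd
  have hh : Primrec fun q : Tape m × (Sym m × Option Turing.Dir) => q.1.1.headD none :=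
    (Primrec.option_getD.comp (Primrec.list_head?.comp hl) (Primrec.const none)).of_eq
      fun q => by simp
  have hstay := hl.pair (Primrec.list_cons.comp ha ht)
  have hleft := (Primrec.list_tail.comp hl).pair
    (Primrec.list_cons.comp hh (Primrec.list_cons.comp ha ht))
  have hright := (Primrec.list_cons.comp ha hl).pair ht
  have hisR : Primrec fun d : Turing.Dir => match d with
      | Turing.Dir.left => false
      | Turing.Dir.right => true :=
    Primrec.of_equiv
  refine (Primrec.option_casesOn (Primrec.snd.comp Primrec.snd) hstay
    (Primrec.cond (hisR.comp Primrec.snd) (hright.comp Primrec.fst)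
      (hleft.comp Primrec.fst)).to₂).of_eq ?_
  rintro ⟨T, a, _ | _ | _⟩ <;> rfl

theorem primrec_bits {m : ℕ} : Primrec (Tape.bits : Tape m → List Bool) := by
  refine Primrec.listFilterMap (Primrec.list_append.comp
    (Primrec.list_reverse.comp Primrec.fst) Primrec.snd) ?_
  exact (Primrec.option_bind Primrec.snd (Primrec.sumCasesOn Primrec.snd
    (Primrec.option_some.comp Primrec.snd).to₂ (Primrec.const none).to₂).to₂).of_eq fun q => by
      rcases q with ⟨_, _ | _ | _⟩ <;> rfl

theorem primrec_step : Primrec V.step := by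
  have hT : Primrec fun q : V.Config × Fin (V.k + 1) => q.1.2 q.2 :=
    Primrec.fin_app.comp (Primrec.snd.comp Primrec.fst) Primrec.snd
  have hr : Primrec fun c : V.Config => fun i => (c.2 i).read :=
    Primrec.fin_curry.2 (primrec_read.comp hT)
  refine Primrec.option_map
    ((Primrec.dom_finite (Function.uncurry V.δ)).comp (Primrec.fst.pair hr)) ?_
  refine (Primrec.fst.comp Primrec.snd).pair (Primrec.fin_curry.2 ?_)
  refine primrec_act.comp ((hT.comp ((Primrec.fst.comp Primrec.fst).pair Primrec.snd)).pair ?_)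
  exact Primrec.fin_app.comp (Primrec.snd.comp (Primrec.snd.comp Primrec.fst)) Primrec.snd

theorem primrec_init : Primrec V.init := by
  refine (Primrec.const 0).pair (Primrec.fin_curry.2 ?_)
  refine Primrec.ite (Primrec.eq.comp Primrec.snd (Primrec.const 0)) ?_ (Primrec.const _)
  exact (Primrec.const []).pair (Primrec.list_map Primrec.fst
    (Primrec.option_some.comp (Primrec.sumInl.comp Primrec.snd)).to₂)

variable (V) in
theorem primrec_runFor : Primrec₂ V.runFor := by
  have hs : Primrec V.stepOrStay := Primrec.option_getD.comp primrec_step Primrec.id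
  have hc : Primrec fun q : ℕ × List Bool => V.stepOrStay^[q.1] (V.init q.2) :=
    Primrec.nat_iterate Primrec.fst (primrec_init.comp Primrec.snd) (hs.comp Primrec.snd).to₂
  exact Primrec.ite (Primrec.eq.comp (primrec_step.comp hc) (Primrec.const none))
    (Primrec.option_some.comp (primrec_bits.comp
      (Primrec.fin_app.comp (Primrec.snd.comp hc) (Primrec.const _)))) (Primrec.const none)

end Machine

/-! ### The strings with short fast programs -/

/-- All bit strings of length at most `L`. -/
def bitLists : ℕ → List (List Bool)
  | 0 => [[]]
  | L + 1 => [] :: (bitLists L).flatMap fun w => [false :: w, true :: w]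

theorem mem_bitLists {L : ℕ} {w : List Bool} : w ∈ bitLists L ↔ w.length ≤ L := by
  induction L generalizing w with
  | zero => simp [bitLists]
  | succ L ih => rcases w with _ | ⟨_ | _, w⟩ <;> simp [bitLists, ih]

/-- There are `2 ^ (L + 1) - 1` strings of length at most `L`. -/
theorem length_bitLists_add_one (L : ℕ) : (bitLists L).length + 1 = 2 ^ (L + 1) := by
  induction L with
  | zero => rfl
  | succ L ih =>
    rw [pow_succ, ← ih]
    simp [bitLists, List.length_flatMap]
    omega

theorem primrec_bitLists : Primrec bitLists := by
  have h2 : Primrec fun w : List Bool => [false :: w, true :: w] :=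
    Primrec.list_cons.comp (Primrec.list_cons.comp (Primrec.const _) Primrec.id)
      (Primrec.list_cons.comp (Primrec.list_cons.comp (Primrec.const _) Primrec.id)
        (Primrec.const []))
  refine (Primrec.nat_rec₁ [[]] (f := fun _ l => [] :: l.flatMap fun w : List Bool =>
    [false :: w, true :: w]) ?_).of_eq fun L => ?_
  · exact Primrec.list_cons.comp (Primrec.const [])
      (Primrec.list_flatMap Primrec.snd (h2.comp Primrec.snd).to₂)
  · induction L with
    | zero => rfl
    | succ L ih => simp only [bitLists, ← ih]

theorem primrecRel_mem {α : Type*} [Primcodable α] :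
    PrimrecRel fun (a : α) (l : List α) => a ∈ l :=
  (PrimrecRel.exists_mem_list (Primrec.eq (α := α))).swap.of_eq fun a l => by
    simp [Function.swap]

theorem primrec_dedup {α : Type*} [Primcodable α] [DecidableEq α] :
    Primrec (List.dedup : List α → List α) := by
  refine (Primrec.list_foldr (f := id) (g := fun _ => []) (σ := List α)
    (h := fun _ q => if q.1 ∈ q.2 then q.2 else q.1 :: q.2) Primrec.id (Primrec.const [])
    (Primrec.ite (primrecRel_mem.comp (Primrec.fst.comp Primrec.snd)
      (Primrec.snd.comp Primrec.snd)) (Primrec.snd.comp Primrec.snd)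
      (Primrec.list_cons.comp (Primrec.fst.comp Primrec.snd)
        (Primrec.snd.comp Primrec.snd))).to₂).of_eq fun l => ?_
  induction l with
  | nil => rfl
  | cons a l ih =>
    simp only [id, List.foldr_cons] at ih ⊢
    rw [ih]
    by_cases h : a ∈ l
    · rw [List.dedup_cons_of_mem h, if_pos (List.mem_dedup.2 h)]
    · rw [List.dedup_cons_of_notMem h, if_neg (mt List.mem_dedup.1 h)]

namespace Machine

/-- The strings which `V` outputs within `t` steps on some program of length at most `L`, listed
without repetition. -/
def outputs (V : Machine) (L t : ℕ) : List (List Bool) :=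
  ((bitLists L).filterMap (V.runFor t)).dedup

variable {V : Machine}

theorem mem_outputs {L t : ℕ} {x : List Bool} :
    x ∈ V.outputs L t ↔ ∃ p t', p.length ≤ L ∧ t' ≤ t ∧ V.HaltsWith p t' x := by
  simp only [outputs, List.mem_dedup, List.mem_filterMap, mem_bitLists, runFor_eq_some_iff]
  tauto

theorem length_outputs_le (L t : ℕ) : (V.outputs L t).length ≤ 2 ^ (L + 1) :=
  calc (V.outputs L t).length ≤ ((bitLists L).filterMap (V.runFor t)).length :=
        (List.dedup_sublist _).length_le
    _ ≤ (bitLists L).length := List.length_filterMap_le _ _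
    _ ≤ 2 ^ (L + 1) := by have := length_bitLists_add_one L; omega

variable (V) in
theorem primrec_outputs : Primrec₂ V.outputs :=
  primrec_dedup.comp (Primrec.listFilterMap (primrec_bitLists.comp Primrec.fst)
    ((primrec_runFor V).comp (Primrec.snd.comp Primrec.fst) Primrec.snd).to₂)

end Machine
end EffDepth

namespace EffDepth

/-! ### Uniform ensembles -/

section Uniform

variable {S : Finset (List Bool)} (hS : S.Nonempty)

theorem prob_uniformOfFinset (s : List Bool) :
    prob (PMF.uniformOfFinset S hS) s = if s ∈ S then (S.card : ℝ)⁻¹ else 0 := by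
  unfold prob
  rw [PMF.uniformOfFinset_apply]
  split_ifs <;> simp

/-- The terms of the entropy of a uniform distribution; outside the support they vanish because
`Real.logb 2 0 = 0`, in agreement with the convention `0 log 0 = 0`. -/
theorem neg_prob_mul_logb_uniformOfFinset (s : List Bool) :
    -(prob (PMF.uniformOfFinset S hS) s * Real.logb 2 (prob (PMF.uniformOfFinset S hS) s)) =
      if s ∈ S then (S.card : ℝ)⁻¹ * Real.logb 2 S.card else 0 := by
  rw [prob_uniformOfFinset]
  split_ifs <;> simp [Real.logb_inv]

theorem entropy_uniformOfFinset :
    entropy (PMF.uniformOfFinset S hS) = Real.logb 2 S.card := by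
  unfold entropy
  simp only [neg_prob_mul_logb_uniformOfFinset]
  rw [tsum_eq_sum (s := S) fun s hs => if_neg hs, Finset.sum_ite_mem, Finset.inter_self,
    Finset.sum_const, nsmul_eq_mul, ← mul_assoc, mul_inv_cancel₀, one_mul]
  exact_mod_cast hS.card_ne_zero

theorem hasFiniteEntropy_uniformOfFinset : HasFiniteEntropy (PMF.uniformOfFinset S hS) := by
  unfold HasFiniteEntropy
  simp only [neg_prob_mul_logb_uniformOfFinset]
  exact summable_of_ne_finset_zero (s := S) fun s hs => if_neg hs

theorem isTypical_uniformOfFinset {d : ℝ} (hd : 0 ≤ d) {x : List Bool} (hx : x ∈ S) :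
    IsTypical d x (PMF.uniformOfFinset S hS) := by
  have h1 : (1 : ℝ) ≤ S.card := by exact_mod_cast hS.card_pos
  have hH : 0 ≤ Real.logb 2 (S.card : ℝ) := Real.logb_nonneg one_lt_two h1
  unfold IsTypical
  rw [entropy_uniformOfFinset, prob_uniformOfFinset, if_pos hx]
  calc (2 : ℝ) ^ (-Real.logb 2 (S.card : ℝ) * (1 + d))
      ≤ 2 ^ (-Real.logb 2 (S.card : ℝ)) :=
        Real.rpow_le_rpow_of_exponent_le one_le_two (by nlinarith)
    _ = (S.card : ℝ)⁻¹ := by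
        rw [Real.rpow_neg zero_le_two, Real.rpow_logb zero_lt_two (by norm_num) (by linarith)]

end Uniform

/-- `a / 2 ^ n` approximates `r` if `a` is the integer part of `r * 2 ^ n`. -/
theorem approx_of_le_of_lt {a n : ℕ} {r : ℝ} (h : (a : ℝ) ≤ r * 2 ^ n) (h' : r * 2 ^ n < a + 1) :
    Approx a n r := by
  have h2 : (0 : ℝ) < 2 ^ n := by positivity
  unfold Approx
  have e : (a : ℝ) / 2 ^ n - r = (a - r * 2 ^ n) / 2 ^ n := by field_simp
  rw [e, abs_div, abs_of_pos h2]
  gcongr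
  rw [abs_le]
  constructor <;> linarith

/-- Rounding down `2 ^ n / N` approximates `1 / N`. -/
theorem approx_inv (N n : ℕ) (hN : N ≠ 0) : Approx (2 ^ n / N) n (N : ℝ)⁻¹ := by
  have hN' : (0 : ℝ) < N := by exact_mod_cast Nat.pos_of_ne_zero hN
  rw [show (N : ℝ)⁻¹ = (1 : ℝ) / N by simp]
  apply approx_of_le_of_lt
  · rw [div_mul_eq_mul_div, one_mul]
    exact_mod_cast Nat.cast_div_le (α := ℝ) (m := 2 ^ n) (n := N)
  · rw [div_mul_eq_mul_div, one_mul, div_lt_iff₀ hN']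
    exact_mod_cast Nat.lt_mul_of_div_lt (Nat.lt_succ_self _) (Nat.pos_of_ne_zero hN)

/-- Integer arithmetic suffices for a binary logarithm: `2 ^ n * log₂ N` is the logarithm of
`N ^ 2 ^ n`, which `Nat.log` rounds down. -/
theorem approx_logb (N n : ℕ) (hN : N ≠ 0) :
    Approx (Nat.log 2 (N ^ 2 ^ n)) n (Real.logb 2 N) := by
  have hN' : (0 : ℝ) < N := by exact_mod_cast Nat.pos_of_ne_zero hN
  have hpow : (0 : ℝ) < (N : ℝ) ^ 2 ^ n := by positivity
  have e : Real.logb 2 N * 2 ^ n = Real.logb 2 ((N : ℝ) ^ 2 ^ n) := by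
    rw [Real.logb_pow]; push_cast; ring
  apply approx_of_le_of_lt
  · rw [e, Real.le_logb_iff_rpow_le one_lt_two hpow, Real.rpow_natCast]
    exact_mod_cast Nat.pow_log_le_self 2 (pow_ne_zero _ hN)
  · rw [e, Real.logb_lt_iff_lt_rpow one_lt_two hpow]
    exact_mod_cast Nat.lt_pow_succ_log_self one_lt_two (N ^ 2 ^ n)

end EffDepth

namespace EffDepth
open Encodable

/-! ### Computing uniform ensembles -/

/-- The approximations which compute the uniform ensemble on the entries of the list `o` (without
repetition) together with its entropy. -/
def uniformApprox (o : List (List Bool)) : (List Bool × ℕ) ⊕ ℕ → ℕ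
  | Sum.inl (s, n) => if s ∈ o then 2 ^ n / o.length else 0
  | Sum.inr n => Nat.log 2 (o.length ^ 2 ^ n)

theorem primrec_pow : Primrec₂ ((· ^ ·) : ℕ → ℕ → ℕ) :=
  Primrec₂.unpaired'.1 Nat.Primrec.pow

theorem primrec_log_two : Primrec (Nat.log 2) := by
  refine (Primrec.nat_findGreatest (f := id) (p := fun a e => 2 ^ e ≤ a) Primrec.id
    (Primrec.nat_le.comp (primrec_pow.comp (Primrec.const 2) Primrec.snd)
      Primrec.fst).primrecRel).of_eq fun a => ?_
  rcases Nat.eq_zero_or_pos a with rfl | ha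
  · simp
  refine (Nat.findGreatest_eq_iff).2 ⟨Nat.log_le_self 2 a, fun _ => Nat.pow_log_le_self 2 ha.ne',
    fun n hn _ hle => ?_⟩
  exact absurd (Nat.le_log_of_pow_le one_lt_two hle) (not_le.2 hn)

theorem primrec_uniformApprox : Primrec₂ uniformApprox := by
  have ho : Primrec fun q : (List (List Bool) × ((List Bool × ℕ) ⊕ ℕ)) × (List Bool × ℕ) =>
      q.1.1 := Primrec.fst.comp Primrec.fst
  refine (Primrec.sumCasesOn Primrec.snd
    (g := fun q sn => if sn.1 ∈ q.1 then 2 ^ sn.2 / q.1.length else 0)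
    (h := fun q n => Nat.log 2 (q.1.length ^ 2 ^ n)) ?_ ?_).of_eq ?_
  · exact Primrec.ite (primrecRel_mem.comp (Primrec.fst.comp Primrec.snd) ho)
      (Primrec.nat_div.comp (primrec_pow.comp (Primrec.const 2) (Primrec.snd.comp Primrec.snd))
        (Primrec.list_length.comp ho)) (Primrec.const 0)
  · exact primrec_log_two.comp (primrec_pow.comp
      (Primrec.list_length.comp (Primrec.fst.comp Primrec.fst))
      (primrec_pow.comp (Primrec.const 2) Primrec.snd))
  · rintro ⟨o, ⟨s, n⟩ | n⟩ <;> rfl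

section

variable {o : List (List Bool)} (ho : o.toFinset.Nonempty)

theorem approx_prob_uniformApprox (hnd : o.Nodup) (s : List Bool) (n : ℕ) :
    Approx (uniformApprox o (Sum.inl (s, n))) n (prob (PMF.uniformOfFinset o.toFinset ho) s) := by
  rw [prob_uniformOfFinset, List.toFinset_card_of_nodup hnd]
  by_cases hs : s ∈ o
  · simpa [uniformApprox, hs] using approx_inv o.length n (List.length_pos_of_mem hs).ne'
  · simp [uniformApprox, hs, Approx]

theorem approx_entropy_uniformApprox (hnd : o.Nodup) (n : ℕ) :
    Approx (uniformApprox o (Sum.inr n)) n (entropy (PMF.uniformOfFinset o.toFinset ho)) := by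
  rw [entropy_uniformOfFinset, List.toFinset_card_of_nodup hnd]
  exact approx_logb o.length n (List.length_pos_of_mem (List.mem_toFinset.1 ho.choose_spec)).ne'

theorem isAdmissible_uniformOfFinset (hnd : o.Nodup) :
    IsAdmissible (PMF.uniformOfFinset o.toFinset ho) := by
  refine ⟨hasFiniteEntropy_uniformOfFinset ho,
    ⟨fun s n => uniformApprox o (Sum.inl (s, n)), ?_, approx_prob_uniformApprox ho hnd⟩,
    ⟨fun n => uniformApprox o (Sum.inr n), ?_, approx_entropy_uniformApprox ho hnd⟩⟩
  · exact (primrec_uniformApprox.comp (Primrec.const o) Primrec.sumInl).to_comp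
  · exact (primrec_uniformApprox.comp (Primrec.const o) Primrec.sumInr).to_comp

end

theorem KEns_le {U : List Bool → ℕ →. ℕ} {q : List Bool} {E : PMF (List Bool)}
    (h : ComputesEnsemble U q E) : KEns U E ≤ q.length :=
  Nat.sInf_le ⟨q, h, rfl⟩

/-! ### The complexity of the ensemble of strings with short fast programs -/

/-- The uniform ensemble on the strings with programs of length at most `n + z` and running time at
most `f n` is described by programs for `n`, for `z` and for `f`. -/
theorem exists_KEns_uniform_outputs_le {U : List Bool → ℕ →. ℕ} (hU : IsUniversalPrefixComputer U)
    (V : Machine) :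
    ∃ ω : ℕ, ∀ f : ℕ → ℕ, Computable f → ∀ (n z : ℕ)
      (ho : (V.outputs (n + z) (f n)).toFinset.Nonempty),
      KEns U (PMF.uniformOfFinset _ ho) ≤ K U n + K U z + KFun U f + ω := by
  -- the arguments of `F` are `n`, `z`, the time bound `f n` and the code of a query to the ensemble
  let F : ℕ × ℕ × ℕ × ℕ → ℕ := fun a =>
    ((decode a.2.2.2 : Option ((List Bool × ℕ) ⊕ ℕ)).map
      (uniformApprox (V.outputs (a.1 + a.2.1) a.2.2.1))).getD 0
  have hF : Primrec F := by
    refine Primrec.option_getD.comp (Primrec.option_map (Primrec.decode.comp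
      (Primrec.snd.comp (Primrec.snd.comp Primrec.snd))) ?_) (Primrec.const 0)
    have e : Primrec fun q : (ℕ × ℕ × ℕ × ℕ) × ((List Bool × ℕ) ⊕ ℕ) => q.1 := Primrec.fst
    have e2 := Primrec.snd.comp e
    exact primrec_uniformApprox.comp ((Machine.primrec_outputs V).comp
      (Primrec.nat_add.comp (Primrec.fst.comp e) (Primrec.fst.comp e2))
      (Primrec.fst.comp (Primrec.snd.comp e2))) Primrec.snd
  obtain ⟨M, hM, hMF⟩ := hU.1.exists_concat hF.to_comp
  obtain ⟨ω, hω⟩ := hU.2 M hM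
  refine ⟨ω, fun f hf n z ho => ?_⟩
  obtain ⟨a, ha, hal⟩ := hU.exists_length_eq_K n
  obtain ⟨b, hb, hbl⟩ := hU.exists_length_eq_K z
  obtain ⟨c, hc, hcl⟩ := hU.exists_length_eq_KFun hf
  obtain ⟨q, hql, hq⟩ := hω (a ++ (b ++ c))
  have key : ∀ y : (List Bool × ℕ) ⊕ ℕ,
      uniformApprox (V.outputs (n + z) (f n)) y ∈ U q (encode y) := fun y => by
    have := hq _ _ (hMF a b c n z (f n) (encode y) ha hb (hc n))
    simpa only [F, encodek, Option.map_some, Option.getD_some] using this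
  have hnd : (V.outputs (n + z) (f n)).Nodup := List.nodup_dedup _
  refine (KEns_le (q := q) ⟨fun s m => ⟨_, key _, approx_prob_uniformApprox ho hnd s m⟩,
    fun m => ⟨_, key _, approx_entropy_uniformApprox ho hnd m⟩⟩).trans (hql.trans ?_)
  simp only [List.length_append]
  omega

/-! ### Depth and effective complexity -/

theorem Machine.IsUniversal.exists_haltsWith {V : Machine} (hV : V.IsUniversal) (x : List Bool) :
    ∃ p t, V.HaltsWith p t x := by
  obtain ⟨c, hc⟩ := hV _ (Computable.const x).partrec
  obtain ⟨q, -, t, h⟩ := hc [] x (Part.mem_some _)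
  exact ⟨q, t, h⟩

/-- The minimum defining the depth of `x` is attained. -/
theorem Machine.IsUniversal.exists_haltsWith_depth {V : Machine} (hV : V.IsUniversal) (z : ℕ)
    (x : List Bool) : ∃ p, V.HaltsWith p (V.depth z x) x ∧ p.length ≤ V.C x + z := by
  obtain ⟨p₀, t₀, h₀⟩ := hV.exists_haltsWith x
  obtain ⟨p, t, h, hp⟩ : ∃ p t, V.HaltsWith p t x ∧ p.length = V.C x :=
    Nat.sInf_mem (s := {n | ∃ p t, V.HaltsWith p t x ∧ p.length = n}) ⟨_, p₀, t₀, h₀, rfl⟩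
  exact Nat.sInf_mem (s := {t | ∃ p, V.HaltsWith p t x ∧ p.length ≤ V.C x + z})
    ⟨t, p, h, by omega⟩

end EffDepth

open EffDepth in
/-- The ensemble that a shallow string `x` would admit is the uniform one on the outputs of `V` on
programs of length at most `C(x) + z` within `f(C(x))` steps; well-behavedness bounds its total
information in terms of `K(x)`. -/
theorem mainTheorem1 (U : List Bool → ℕ →. ℕ) (hU : EffDepth.IsUniversalPrefixComputer U)
    (V : EffDepth.Machine) (hV : V.IsUniversal) :
    ∃ ω : ℕ, ∀ f : ℕ → ℕ, StrictMono f → Computable f →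
      ∀ (k : ℕ) (x : List Bool), EffDepth.IsWellBehaved U V k x →
      ∀ d : ℝ, 0 ≤ d → ∀ z : ℕ,
        ((EffDepth.K U (V.C x) + EffDepth.K U z + EffDepth.KFun U f + ω : ℕ) : ℕ∞) <
          EffDepth.effComplexity U d
            ((k + z + EffDepth.K U z + EffDepth.KFun U f + ω + 1 : ℕ) : ℝ) x →
        f (V.C x) < V.depth z x := by
  obtain ⟨ω, hω⟩ := exists_KEns_uniform_outputs_le hU V
  refine ⟨ω, fun f _ hf k x hx d hd z hlt => ?_⟩
  by_contra! hle
  obtain ⟨p, hp, hpl⟩ := hV.exists_haltsWith_depth z x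
  have hxo : x ∈ (V.outputs (V.C x + z) (f (V.C x))).toFinset :=
    List.mem_toFinset.2 (Machine.mem_outputs.2 ⟨p, _, hpl, hle, hp⟩)
  have ho : (V.outputs (V.C x + z) (f (V.C x))).toFinset.Nonempty := ⟨x, hxo⟩
  have hK := hω f hf (V.C x) z ho
  -- there are fewer than `2 ^ (C(x) + z + 1)` programs of length at most `C(x) + z`
  have hH : entropy (PMF.uniformOfFinset _ ho) ≤ (V.C x + z + 1 : ℕ) := by
    rw [entropy_uniformOfFinset, Real.logb_le_iff_le_rpow one_lt_two
      (by exact_mod_cast ho.card_pos), Real.rpow_natCast]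
    exact_mod_cast (List.toFinset_card_le _).trans (Machine.length_outputs_le _ _)
  refine absurd hlt (not_lt.2 ((iInf₂_le (PMF.uniformOfFinset _ ho)
    ⟨isAdmissible_uniformOfFinset ho (List.nodup_dedup _),
      isTypical_uniformOfFinset ho hd hxo, ?_⟩).trans (by exact_mod_cast hK)))
  have hK' : (KEns U (PMF.uniformOfFinset _ ho) : ℝ) ≤
      K U (V.C x) + K U z + KFun U f + ω := by exact_mod_cast hK
  have hx' : (V.C x + K U (V.C x) : ℝ) ≤ K U x + k := by exact_mod_cast hx
  unfold totalInfo
  push_cast at hH ⊢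
  linarith
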